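/- Let $\Sigma$ be a nonempty set. An operation $f:\Sigma^n\to\Sigma$ is an \emph{$n$-ary quasigroup of order $|\Sigma|$} if in the equality $z_0=f(z_1,\ldots,z_n)$ any $n$ of the elements $z_0,z_1,\ldots,z_n$ uniquely specify the remaining one. An $n$-ary quasigroup $f$ is \emph{(permutably) reducible} if there are an integer $m$ with $1<m<n$, a permutation $\sigma$ of $\{1,\ldots,n\}$, an $m$-ary quasigroup $g$ and an $(n-m+1)$-ary quasigroup $h$ on $\Sigma$ such that $$f(x_1,\ldots,x_n)=h\bigl(g(x_{\sigma(1)},\ldots,x_{\sigma(m)}),x_{\sigma(m+1)},\ldots,x_{\sigma(n)}\bigr)$$ for all $x_1,\ldots,x_n\in\Sigma$; otherwise $f$ is \emph{irreducible}. Theorem. For every integer $n\ge 3$ and every cardinal number $k\ge 4$, finite or infinite, there exists an irreducible $n$-ary quasigroup of order $k$. -/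

import Mathlib

universe u

/-- An `n`-ary operation `f : Σⁿ → Σ` is an `n`-ary quasigroup if in the equality
`z₀ = f (z₁, …, zₙ)` any `n` of the elements `z₀, z₁, …, zₙ` uniquely specify the remaining one.
For `z₀` this is automatic, `f` being an operation; for `zᵢ` with `1 ≤ i ≤ n` it says that
the equation `f (x₁, …, a, …, xₙ) = b`, with `a` in the `i`-th place, has exactly one
solution `a`. -/
def IsNQuasigroup {S : Type*} {n : ℕ} (f : (Fin n → S) → S) : Prop :=
  ∀ (i : Fin n) (x : Fin n → S) (b : S), ∃! a : S, f (Function.update x i a) = b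

/-- `f` is (permutably) reducible:
`f (x₁, …, xₙ) = h (g (x_{σ 1}, …, x_{σ m}), x_{σ (m+1)}, …, x_{σ n})` identically, for some
`m` with `1 < m < n`, some permutation `σ`, some `m`-ary quasigroup `g` and some
`(n - m + 1)`-ary quasigroup `h` on the same set. Here `l = n - m`. -/
def IsPermutablyReducible {S : Type*} {n : ℕ} (f : (Fin n → S) → S) : Prop :=
  ∃ (m l : ℕ) (hml : m + l = n) (σ : Equiv.Perm (Fin n))
    (g : (Fin m → S) → S) (h : (Fin (l + 1) → S) → S),
    1 < m ∧ m < n ∧ IsNQuasigroup g ∧ IsNQuasigroup h ∧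
      ∀ x : Fin n → S,
        f x = h (Fin.cons (g fun i : Fin m => x (σ (Fin.cast hml (Fin.castAdd l i))))
          fun j : Fin l => x (σ (Fin.cast hml (Fin.natAdd m j))))

/-! Take a loop containing a subloop {1, t} of order two, form the n-fold right-nested product, and
interchange the values 1 and t on tuples lying in the subloop. This stays a quasigroup
(`switched_isNQuasigroup`), because a product with all but one factor in the subloop lies in it
exactly when the last factor does. A reduction would give a set M of places on which equality of
values is independent of the entries outside M (`exists_set`). After switching, the all-1 tuple
takes the value t, as does a tuple with w, w' on M and 1 elsewhere, where ww' = t. An outside entry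
beyond the subloop turns the switching off, and the two values separate (`switched_not_reducible`).
Such loops exist in every order at least 4: Z₂ × A serves for even and infinite orders. A group of
odd order has no involution, so odd orders use a two-step prolongation of the quasigroup 2a - b over
Z_{2m+1}. -/

/-- A loop with an element `t` of order two, such that `{one, t}` is a subloop, together with
elements outside this subloop which witness that switching the values `one` and `t` on the
subloop destroys associativity up to permutation. -/
structure SwitchableLoop (S : Type*) where
  op : S → S → S
  one : S
  t : S
  w : S
  w' : S
  z : S
  bijective_left : ∀ a, Function.Bijective (op a)
  bijective_right : ∀ b, Function.Bijective fun a => op a b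
  one_op : ∀ a, op one a = a
  op_one : ∀ a, op a one = a
  t_ne_one : t ≠ one
  t_op_t : op t t = one
  w_op_w' : op w w' = t
  w_ne_one : w ≠ one
  w_ne_t : w ≠ t
  z_ne_one : z ≠ one
  z_ne_t : z ≠ t
  op_op_ne : op w (op w' z) ≠ z
  op_op_ne' : op w (op z w') ≠ z

/-! ### Right-nested products and the subloop of order two -/

namespace SwitchableLoop

variable {S : Type*} (L : SwitchableLoop S)

/-- Membership in the subloop of order two. -/
def Small (a : S) : Prop := a = L.one ∨ a = L.t

theorem small_one : L.Small L.one := Or.inl rfl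

theorem w_not_small : ¬ L.Small L.w := by
  rintro (h | h)
  · exact L.w_ne_one h
  · exact L.w_ne_t h

theorem z_not_small : ¬ L.Small L.z := by
  rintro (h | h)
  · exact L.z_ne_one h
  · exact L.z_ne_t h

theorem small_op_iff_right {a b : S} (ha : L.Small a) : L.Small (L.op a b) ↔ L.Small b := by
  rcases ha with rfl | rfl
  · rw [L.one_op]
  · constructor
    · rintro (h | h)
      · exact Or.inr ((L.bijective_left L.t).1 (by rw [h, L.t_op_t]))
      · exact Or.inl ((L.bijective_left L.t).1 (by rw [h, L.op_one]))
    · rintro (rfl | rfl)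
      · exact Or.inr (L.op_one _)
      · exact Or.inl L.t_op_t

theorem small_op_iff_left {a b : S} (hb : L.Small b) : L.Small (L.op a b) ↔ L.Small a := by
  rcases hb with rfl | rfl
  · rw [L.op_one]
  · constructor
    · rintro (h | h)
      · exact Or.inr ((L.bijective_right L.t).1 (by simp only [h, L.t_op_t]))
      · exact Or.inl ((L.bijective_right L.t).1 (by simp only [h, L.one_op]))
    · rintro (rfl | rfl)
      · exact Or.inr (L.one_op _)
      · exact Or.inl L.t_op_t

/-- The right-nested product `x₁ (x₂ (⋯ xₙ))`. -/
def prod : {n : ℕ} → (Fin n → S) → S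
  | 0, _ => L.one
  | _ + 1, x => L.op (x 0) (prod (Fin.tail x))

theorem prod_succ {n : ℕ} (x : Fin (n + 1) → S) :
    L.prod x = L.op (x 0) (L.prod (Fin.tail x)) := rfl

theorem prod_update_bijective {n : ℕ} (i : Fin n) (x : Fin n → S) :
    Function.Bijective fun a => L.prod (Function.update x i a) := by
  induction n with
  | zero => exact i.elim0
  | succ n ih =>
    induction i using Fin.cases with
    | zero =>
      simp only [prod_succ, Function.update_self, Fin.tail_update_zero]
      exact L.bijective_right _
    | succ i =>
      simp only [prod_succ, Fin.tail_update_succ,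
        Function.update_of_ne (Fin.succ_ne_zero i).symm]
      exact (L.bijective_left _).comp (ih i _)

theorem small_prod {n : ℕ} {x : Fin n → S} (hx : ∀ i, L.Small (x i)) : L.Small (L.prod x) := by
  induction n with
  | zero => exact L.small_one
  | succ n ih =>
    rw [prod_succ, L.small_op_iff_right (hx 0)]
    exact ih fun i => hx i.succ

/-- Translations by `one` and `t` preserve both the subloop and its complement. This is what makes
switching compatible with unique solvability. -/
theorem small_prod_iff {n : ℕ} (i : Fin n) {x : Fin n → S} (hx : ∀ j, j ≠ i → L.Small (x j)) :
    L.Small (L.prod x) ↔ L.Small (x i) := by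
  induction n with
  | zero => exact i.elim0
  | succ n ih =>
    induction i using Fin.cases with
    | zero =>
      rw [prod_succ, L.small_op_iff_left]
      exact L.small_prod fun j => hx j.succ (Fin.succ_ne_zero j)
    | succ i =>
      rw [prod_succ, L.small_op_iff_right (hx 0 (Fin.succ_ne_zero i).symm)]
      exact ih i fun j hj => hx j.succ fun h => hj (Fin.succ_injective _ h)

theorem prod_eq_one {n : ℕ} {x : Fin n → S} (hx : ∀ i, x i = L.one) : L.prod x = L.one := by
  induction n with
  | zero => rfl
  | succ n ih =>
    rw [prod_succ, hx 0, L.one_op]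
    exact ih fun i => hx i.succ

theorem prod_eq_single {n : ℕ} (i : Fin n) {x : Fin n → S} (hx : ∀ k, k ≠ i → x k = L.one) :
    L.prod x = x i := by
  induction n with
  | zero => exact i.elim0
  | succ n ih =>
    induction i using Fin.cases with
    | zero =>
      rw [prod_succ, L.prod_eq_one (x := Fin.tail x) fun k => hx k.succ (Fin.succ_ne_zero k),
        L.op_one]
    | succ i =>
      rw [prod_succ, hx 0 (Fin.succ_ne_zero i).symm, L.one_op]
      exact ih i fun k hk => hx k.succ fun h => hk (Fin.succ_injective _ h)

theorem prod_eq_pair {n : ℕ} {i j : Fin n} (hij : i < j) {x : Fin n → S}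
    (hx : ∀ k, k ≠ i → k ≠ j → x k = L.one) : L.prod x = L.op (x i) (x j) := by
  induction n with
  | zero => exact i.elim0
  | succ n ih =>
    obtain ⟨j, rfl⟩ := Fin.exists_succ_eq.2 (Fin.ne_zero_of_lt hij)
    induction i using Fin.cases with
    | zero =>
      rw [prod_succ, L.prod_eq_single j]
      · rfl
      · exact fun k hk => hx k.succ (Fin.succ_ne_zero k) fun h => hk (Fin.succ_injective _ h)
    | succ i =>
      rw [prod_succ, hx 0 (Fin.succ_ne_zero i).symm (Fin.succ_ne_zero j).symm, L.one_op]
      exact ih (Fin.succ_lt_succ_iff.1 hij) fun k hk hk' => hx k.succ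
        (fun h => hk (Fin.succ_injective _ h)) fun h => hk' (Fin.succ_injective _ h)

theorem prod_eq_triple {n : ℕ} {i j l : Fin n} (hij : i < j) (hjl : j < l) {x : Fin n → S}
    (hx : ∀ k, k ≠ i → k ≠ j → k ≠ l → x k = L.one) :
    L.prod x = L.op (x i) (L.op (x j) (x l)) := by
  induction n with
  | zero => exact i.elim0
  | succ n ih =>
    obtain ⟨j, rfl⟩ := Fin.exists_succ_eq.2 (Fin.ne_zero_of_lt hij)
    obtain ⟨l, rfl⟩ := Fin.exists_succ_eq.2 (Fin.ne_zero_of_lt hjl)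
    have hjl' := Fin.succ_lt_succ_iff.1 hjl
    induction i using Fin.cases with
    | zero =>
      rw [prod_succ, L.prod_eq_pair hjl']
      · rfl
      · exact fun k hk hk' => hx k.succ (Fin.succ_ne_zero k)
          (fun h => hk (Fin.succ_injective _ h)) fun h => hk' (Fin.succ_injective _ h)
    | succ i =>
      rw [prod_succ, hx 0 (Fin.succ_ne_zero i).symm (Fin.succ_ne_zero j).symm
        (Fin.succ_ne_zero l).symm, L.one_op]
      exact ih (Fin.succ_lt_succ_iff.1 hij) hjl' fun k h₁ h₂ h₃ => hx k.succ
        (fun h => h₁ (Fin.succ_injective _ h)) (fun h => h₂ (Fin.succ_injective _ h))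
        fun h => h₃ (Fin.succ_injective _ h)

/-! ### The switched product -/

open Classical in
/-- The product with the values `one` and `t` interchanged on the subloop of order two. -/
noncomputable def switched {n : ℕ} (x : Fin n → S) : S :=
  if ∀ i, L.Small (x i) then Equiv.swap L.one L.t (L.prod x) else L.prod x

theorem switched_isNQuasigroup (n : ℕ) : IsNQuasigroup (L.switched (n := n)) := by
  classical
  intro i x
  rw [← Function.bijective_iff_existsUnique]
  -- If the other entries are in the subloop, the swap may be applied along the whole line, since it
  -- fixes values outside the subloop. Otherwise no switching occurs on the line.
  by_cases hx : ∀ j, j ≠ i → L.Small (x j)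
  · have key : (fun a => L.switched (Function.update x i a)) =
        Equiv.swap L.one L.t ∘ fun a => L.prod (Function.update x i a) := by
      funext a
      have ha : ∀ j, j ≠ i → L.Small (Function.update x i a j) := fun j hj => by
        rw [Function.update_of_ne hj]
        exact hx j hj
      simp only [switched, Function.comp_apply]
      split_ifs with h
      · rfl
      · have hP : ¬ L.Small (L.prod (Function.update x i a)) := by
          rw [L.small_prod_iff i ha]
          intro hi
          refine h fun j => ?_
          by_cases hj : j = i
          · exact hj ▸ hi
          · exact ha j hj
        exact (Equiv.swap_apply_of_ne_of_ne (fun h => hP (Or.inl h)) fun h => hP (Or.inr h)).symm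
    rw [key]
    exact (Equiv.bijective _).comp (L.prod_update_bijective i x)
  · push Not at hx
    obtain ⟨j, hj, hxj⟩ := hx
    have key : (fun a => L.switched (Function.update x i a)) =
        fun a => L.prod (Function.update x i a) := by
      funext a
      refine if_neg fun h => hxj ?_
      have := h j
      rwa [Function.update_of_ne hj] at this
    rw [key]
    exact L.prod_update_bijective i x

/-- The tuple with entries `a`, `b`, `c` at the places `p`, `q`, `r` and `one` elsewhere. -/
def triple {n : ℕ} (p q r : Fin n) (a b c : S) : Fin n → S :=
  fun k => if k = p then a else if k = q then b else if k = r then c else L.one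

theorem prod_triple {n : ℕ} {p q r : Fin n} (hpq : p < q) (hqr : q < r) (a b c : S) :
    L.prod (L.triple p q r a b c) = L.op a (L.op b c) := by
  rw [L.prod_eq_triple hpq hqr]
  · simp [triple, hpq.ne', hqr.ne', (hpq.trans hqr).ne']
  · intro k h₁ h₂ h₃
    simp [triple, h₁, h₂, h₃]

theorem switched_triple_small {n : ℕ} {p q r : Fin n} (hpq : p < q) (hqr : q < r) :
    L.switched (L.triple p q r L.one L.one L.one) = L.t := by
  classical
  rw [switched, if_pos, L.prod_triple hpq hqr, L.one_op, L.one_op, Equiv.swap_apply_left]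
  intro i
  simp [triple, L.small_one]

theorem switched_triple {n : ℕ} {p q r : Fin n} (hpq : p < q) (hqr : q < r) {a b c : S}
    (h : ¬ L.Small a ∨ ¬ L.Small b ∨ ¬ L.Small c) :
    L.switched (L.triple p q r a b c) = L.op a (L.op b c) := by
  rw [switched, if_neg, L.prod_triple hpq hqr]
  intro hs
  have h₁ := hs p
  have h₂ := hs q
  have h₃ := hs r
  simp only [triple, hpq.ne', hqr.ne', (hpq.trans hqr).ne', if_true, if_false] at h₁ h₂ h₃
  tauto

end SwitchableLoop

/-! ### Irreducibility -/

/-- In a reducible quasigroup there is a nontrivial set `M` of places such that whether two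
partial tuples on `M` yield the same value does not depend on the entries outside `M`. -/
theorem IsPermutablyReducible.exists_set {S : Type*} {n : ℕ} {f : (Fin n → S) → S}
    (hf : IsPermutablyReducible f) :
    ∃ M : Set (Fin n), M.Nontrivial ∧ Mᶜ.Nonempty ∧
      ∀ x y x' y' : Fin n → S, (∀ k ∉ M, x k = y k) → (∀ k ∉ M, x' k = y' k) →
        (∀ k ∈ M, x k = x' k) → (∀ k ∈ M, y k = y' k) → f x = f y → f x' = f y' := by
  obtain ⟨m, l, rfl, σ, g, h, hm, hml, -, hh, hf⟩ := hf
  have hσ : ∀ j : Fin l, σ (Fin.natAdd m j) ∉ Set.range fun i : Fin m => σ (Fin.castAdd l i) := by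
    rintro j ⟨i, hi⟩
    have := congrArg Fin.val (σ.injective hi)
    simp only [Fin.val_castAdd, Fin.val_natAdd] at this
    omega
  refine ⟨Set.range fun i : Fin m => σ (Fin.castAdd l i), ?_,
    ⟨_, hσ ⟨0, by omega⟩⟩, ?_⟩
  · refine ⟨_, ⟨⟨0, by omega⟩, rfl⟩, _, ⟨⟨1, hm⟩, rfl⟩, fun h => ?_⟩
    have := congrArg Fin.val (σ.injective h)
    simp at this
  · intro x y x' y' hxy hxy' hxx hyy he
    simp only [hf, Fin.cast_refl, id_eq] at he ⊢
    have e₁ : (fun j : Fin l => x (σ (Fin.natAdd m j))) = fun j => y (σ (Fin.natAdd m j)) :=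
      funext fun j => hxy _ (hσ j)
    have e₂ : (fun j : Fin l => x' (σ (Fin.natAdd m j))) = fun j => y' (σ (Fin.natAdd m j)) :=
      funext fun j => hxy' _ (hσ j)
    have e₃ : (fun i : Fin m => x (σ (Fin.castAdd l i))) = fun i => x' (σ (Fin.castAdd l i)) :=
      funext fun i => hxx _ ⟨i, rfl⟩
    have e₄ : (fun i : Fin m => y (σ (Fin.castAdd l i))) = fun i => y' (σ (Fin.castAdd l i)) :=
      funext fun i => hyy _ ⟨i, rfl⟩
    rw [e₁, e₃, e₄] at he
    rw [e₂]
    have hg : g (fun i => x' (σ (Fin.castAdd l i))) = g fun i => y' (σ (Fin.castAdd l i)) := by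
      -- `h` is cancellable in its first argument.
      refine (hh 0 (Fin.cons (g fun i => x' (σ (Fin.castAdd l i)))
        fun j => y (σ (Fin.natAdd m j))) _).unique ?_ rfl
      rw [Fin.update_cons_zero, Fin.update_cons_zero]
      exact he
    rw [hg]

namespace SwitchableLoop

variable {S : Type*} (L : SwitchableLoop S)

theorem switched_not_reducible {n : ℕ} :
    ¬ IsPermutablyReducible (L.switched (n := n + 1)) := by
  intro hred
  obtain ⟨M, ⟨p, hp, q, hq, hpq⟩, ⟨c, hc⟩, hM⟩ := hred.exists_set
  -- The product is right-nested, so the position of the outside place matters. If the last place is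
  -- outside M, it serves as the outside place; if it is in M, it carries w' and the outside place
  -- lies before or after p.
  have first_two : ∀ p q : Fin (n + 1), p ∈ M → q ∈ M → Fin.last n ∉ M → p < q → False := by
    intro p q hp hq hl hpq
    have hql : q < Fin.last n := lt_of_le_of_ne (Fin.le_last q) fun h => hl (h ▸ hq)
    -- Both values are t when the outside entry is `one`; the outside entry z would force w(w'z) =
    -- z.
    have := hM (L.triple p q (Fin.last n) L.w L.w' L.one)
      (L.triple p q (Fin.last n) L.one L.one L.one)
      (L.triple p q (Fin.last n) L.w L.w' L.z) (L.triple p q (Fin.last n) L.one L.one L.z)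
      (by intro k hk; simp only [triple]; grind) (by intro k hk; simp only [triple]; grind)
      (by intro k hk; simp only [triple]; grind) (by intro k hk; simp only [triple]; grind)
      (by rw [L.switched_triple_small hpq hql, L.switched_triple hpq hql (Or.inl L.w_not_small),
            L.op_one, L.w_op_w'])
    rw [L.switched_triple hpq hql (Or.inl L.w_not_small),
      L.switched_triple hpq hql (Or.inr (Or.inr L.z_not_small)), L.one_op, L.one_op] at this
    exact L.op_op_ne this
  have with_last : ∀ p c : Fin (n + 1), p ∈ M → c ∉ M → p ≠ Fin.last n → Fin.last n ∈ M →
      False := by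
    intro p c hp hc hpl hl
    have hcl : c < Fin.last n := lt_of_le_of_ne (Fin.le_last c) fun h => hc (h ▸ hl)
    have hpl : p < Fin.last n := lt_of_le_of_ne (Fin.le_last p) hpl
    rcases lt_trichotomy p c with h | h | h
    · have := hM (L.triple p c (Fin.last n) L.w L.one L.w')
        (L.triple p c (Fin.last n) L.one L.one L.one)
        (L.triple p c (Fin.last n) L.w L.z L.w') (L.triple p c (Fin.last n) L.one L.z L.one)
        (by intro k hk; simp only [triple]; grind) (by intro k hk; simp only [triple]; grind)
        (by intro k hk; simp only [triple]; grind) (by intro k hk; simp only [triple]; grind)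
        (by rw [L.switched_triple_small h hcl, L.switched_triple h hcl (Or.inl L.w_not_small),
              L.one_op, L.w_op_w'])
      rw [L.switched_triple h hcl (Or.inl L.w_not_small),
        L.switched_triple h hcl (Or.inr (Or.inl L.z_not_small)), L.one_op, L.op_one] at this
      exact L.op_op_ne' this
    · exact hc (h ▸ hp)
    -- Here the outside factor comes first, so left cancellation suffices: any outside entry beyond
    -- the subloop works, w for instance, and yields t = 1.
    · have := hM (L.triple c p (Fin.last n) L.one L.w L.w')
        (L.triple c p (Fin.last n) L.one L.one L.one)
        (L.triple c p (Fin.last n) L.w L.w L.w') (L.triple c p (Fin.last n) L.w L.one L.one)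
        (by intro k hk; simp only [triple]; grind) (by intro k hk; simp only [triple]; grind)
        (by intro k hk; simp only [triple]; grind) (by intro k hk; simp only [triple]; grind)
        (by rw [L.switched_triple_small h hpl,
              L.switched_triple h hpl (Or.inr (Or.inl L.w_not_small)), L.one_op, L.w_op_w'])
      rw [L.switched_triple h hpl (Or.inl L.w_not_small),
        L.switched_triple h hpl (Or.inl L.w_not_small), L.op_one, L.w_op_w'] at this
      exact L.t_ne_one ((L.bijective_left _).1 this)
  by_cases hl : Fin.last n ∈ M
  · by_cases hpl : p = Fin.last n
    · exact with_last q c hq hc (fun h => hpq (hpl.trans h.symm)) hl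
    · exact with_last p c hp hc hpl hl
  · rcases lt_or_gt_of_ne hpq with h | h
    · exact first_two p q hp hq hl h
    · exact first_two q p hq hp hl h

/-! ### Constructions of switchable loops -/

/-- An abelian group with an involution `t` and an element `w` other than `0` and `t`. -/
def ofAddCommGroup {G : Type*} [AddCommGroup G] (t w : G) (ht : t ≠ 0) (htt : t + t = 0)
    (hw : w ≠ 0) (hwt : w ≠ t) : SwitchableLoop G where
  op := (· + ·)
  one := 0
  t := t
  w := w
  w' := t - w
  z := w
  bijective_left := AddGroup.addLeft_bijective
  bijective_right := AddGroup.addRight_bijective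
  one_op := zero_add
  op_one := add_zero
  t_ne_one := ht
  t_op_t := htt
  w_op_w' := by abel
  w_ne_one := hw
  w_ne_t := hwt
  z_ne_one := hw
  z_ne_t := hwt
  op_op_ne h := ht (by simpa using h)
  op_op_ne' h := ht (by simpa using h)

/-- The prolongation of the idempotent quasigroup `2 a - b` on a ring along the transversals
`a = b` and `a = b + 1`; the element `none` is the identity. -/
def prolongedOp {R : Type*} [CommRing R] [DecidableEq R] :
    Option (Option R) → Option (Option R) → Option (Option R)
  | none, b => b
  | a, none => a
  | some none, some none => none
  | some none, some (some b) => some (some (b + 2))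
  | some (some a), some none => some (some (a + 1))
  | some (some a), some (some b) =>
    if a = b then none else if a = b + 1 then some none else some (some (2 * a - b))

/-- The transversals a = b and a = b + 1 are disjoint as 1 ≠ 0, and carry the values a and a + 1.
These displaced values fill the borders, and the new symbols replace them; the corner is a copy of
Z₂. -/
theorem prolongedOp_bijective_left {R : Type*} [CommRing R] [DecidableEq R] [Nontrivial R]
    (a : Option (Option R)) : Function.Bijective (prolongedOp a) := by
  rw [Function.bijective_iff_has_inverse]
  rcases a with _ | _ | a
  · exact ⟨id, fun b => rfl, fun b => rfl⟩
  · refine ⟨fun | none => some none | some none => none | some (some c) => some (some (c - 2)),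
      ?_, ?_⟩
    · rintro (_ | _ | b) <;> simp [prolongedOp]
    · rintro (_ | _ | b) <;> simp [prolongedOp]
  · refine ⟨fun
      | none => some (some a)
      | some none => some (some (a - 1))
      | some (some c) =>
        if c = a then none else if c = a + 1 then some none else some (some (2 * a - c)), ?_, ?_⟩
    · rintro (_ | _ | b)
      · simp [prolongedOp]
      · simp [prolongedOp]
      · simp only [prolongedOp]
        grind
    · rintro (_ | _ | c)
      · simp [prolongedOp]
      · have h : a ≠ a - 1 := fun h => one_ne_zero (α := R) (by linear_combination h)
        simp [prolongedOp, h]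
      · simp only
        split_ifs with h₁ h₂
        · simp [prolongedOp, h₁]
        · simp [prolongedOp, h₂]
        · simp only [prolongedOp]
          rw [if_neg (by grind), if_neg (by grind), sub_sub_cancel]

/-- Solving 2a - b = c for a requires halving, which `r` provides. -/
theorem prolongedOp_bijective_right {R : Type*} [CommRing R] [DecidableEq R] [Nontrivial R]
    {r : R} (hr : 2 * r = 1) (b : Option (Option R)) :
    Function.Bijective fun a => prolongedOp a b := by
  have two_ne : (2 : R) ≠ 0 := fun h => by simp [h] at hr
  rw [Function.bijective_iff_has_inverse]
  rcases b with _ | _ | b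
  · exact ⟨id, by rintro (_ | _ | a) <;> rfl, by rintro (_ | _ | a) <;> rfl⟩
  · refine ⟨fun | none => some none | some none => none | some (some c) => some (some (c - 1)),
      ?_, ?_⟩
    · rintro (_ | _ | b) <;> simp [prolongedOp]
    · rintro (_ | _ | b) <;> simp [prolongedOp]
  · refine ⟨fun
      | none => some (some b)
      | some none => some (some (b + 1))
      | some (some c) =>
        if c = b then none else if c = b + 2 then some none else some (some (r * (b + c))), ?_, ?_⟩
    · rintro (_ | _ | a)
      · simp [prolongedOp]
      · simp [prolongedOp, two_ne]
      · simp only [prolongedOp]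
        split_ifs with h₁ h₂
        · simp [h₁]
        · simp [h₂]
        · simp only
          rw [if_neg, if_neg]
          · congr 2
            linear_combination a * hr
          · intro h
            exact h₂ (by linear_combination r * h + (b + 1 - a) * hr)
          · intro h
            exact h₁ (by linear_combination r * h + (b - a) * hr)
    · rintro (_ | _ | c)
      · simp [prolongedOp]
      · simp [prolongedOp]
      · simp only
        split_ifs with h₁ h₂
        · simp [prolongedOp, h₁]
        · simp [prolongedOp, h₂]
        · simp only [prolongedOp]
          rw [if_neg, if_neg]
          · congr 2
            linear_combination (b + c) * hr
          · intro h
            exact h₂ (by linear_combination 2 * h - (b + c) * hr)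
          · intro h
            exact h₁ (by linear_combination 2 * h - (b + c) * hr)

/-- The loop of exponent two obtained by adjoining two elements to a ring in which `2` is
invertible. -/
def ofCommRing {R : Type*} [CommRing R] [DecidableEq R] [Nontrivial R] {r : R}
    (hr : 2 * r = 1) : SwitchableLoop (Option (Option R)) where
  op := prolongedOp
  one := none
  t := some none
  w := some (some 1)
  w' := some (some 0)
  z := some (some 0)
  bijective_left := prolongedOp_bijective_left
  bijective_right := prolongedOp_bijective_right hr
  one_op _ := rfl
  op_one := by rintro (_ | _ | a) <;> rfl
  t_ne_one := by simp
  t_op_t := rfl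
  w_op_w' := by simp [prolongedOp]
  w_ne_one := by simp
  w_ne_t := by simp
  z_ne_one := by simp
  z_ne_t := by simp
  op_op_ne := by simp [prolongedOp]
  op_op_ne' := by simp [prolongedOp]

end SwitchableLoop

/-! ### Existence in every order at least 4 -/

theorem exists_switchableLoop_of_infinite (k : Cardinal.{u}) (hk : Cardinal.aleph0 ≤ k) :
    ∃ S : Type u, Cardinal.mk S = k ∧ Nonempty (SwitchableLoop S) := by
  have : Infinite k.out := Cardinal.infinite_iff.2 (by rwa [Cardinal.mk_out])
  -- Only an abelian group structure with a nonzero element, here 1, is needed.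
  obtain ⟨K⟩ := Infinite.nonempty_field (α := k.out)
  refine ⟨ULift.{u} (ZMod 2) × k.out, ?_,
    ⟨.ofAddCommGroup (1, 0) (0, 1) ?_ ?_ ?_ ?_⟩⟩
  · rw [Cardinal.mk_prod, Cardinal.lift_id, Cardinal.lift_id, Cardinal.mk_out]
    refine Cardinal.mul_eq_right hk ((Cardinal.mk_le_aleph0).trans hk) (Cardinal.mk_ne_zero _)
  · simp
  · exact Prod.ext (ULift.ext _ _ (show (1 + 1 : ZMod 2) = 0 by decide)) (add_zero _)
  · simp
  · simp

theorem exists_switchableLoop_of_even (m : ℕ) (hm : 2 ≤ m) :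
    ∃ S : Type u, Cardinal.mk S = (2 * m : ℕ) ∧ Nonempty (SwitchableLoop S) := by
  have : NeZero m := ⟨by omega⟩
  have : Fact (1 < m) := ⟨hm⟩
  refine ⟨ULift.{u} (ZMod 2 × ZMod m), ?_,
    ⟨.ofAddCommGroup ⟨(1, 0)⟩ ⟨(0, 1)⟩ ?_ ?_ ?_ ?_⟩⟩
  · simp [ZMod.card]
  · simp [ULift.ext_iff]
  · refine ULift.ext _ _ (Prod.ext (show (1 + 1 : ZMod 2) = 0 by decide) (add_zero _))
  · simp [ULift.ext_iff]
  · simp [ULift.ext_iff]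

theorem exists_switchableLoop_of_odd (m : ℕ) (hm : 1 ≤ m) :
    ∃ S : Type u, Cardinal.mk S = (2 * m + 3 : ℕ) ∧ Nonempty (SwitchableLoop S) := by
  have : Fact (1 < 2 * m + 1) := ⟨by omega⟩
  refine ⟨Option (Option (ULift.{u} (ZMod (2 * m + 1)))), ?_,
    -- The inverse of 2 modulo 2m + 1 is -m, since -2m = 1 - (2m + 1).
    ⟨.ofCommRing (r := -(m : ULift.{u} (ZMod (2 * m + 1)))) ?_⟩⟩
  · simp only [Cardinal.mk_fintype]
    simp
    norm_cast
  · have h := ZMod.natCast_self (2 * m + 1)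
    push_cast at h
    refine ULift.ext _ _ ?_
    change 2 * -(m : ZMod (2 * m + 1)) = 1
    linear_combination -h

theorem exists_switchableLoop (k : Cardinal.{u}) (hk : 4 ≤ k) :
    ∃ S : Type u, Cardinal.mk S = k ∧ Nonempty (SwitchableLoop S) := by
  rcases le_or_gt Cardinal.aleph0 k with h | h
  · exact exists_switchableLoop_of_infinite k h
  · obtain ⟨k, rfl⟩ := Cardinal.lt_aleph0.1 h
    have hk : 4 ≤ k := by exact_mod_cast hk
    rcases Nat.even_or_odd' k with ⟨m, rfl | rfl⟩
    · exact exists_switchableLoop_of_even m (by omega)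
    -- Shift m by one: 2(m + 1) + 1 = 2m + 3, the ring's 2m + 1 elements and two adjoined ones.
    · obtain ⟨m, rfl⟩ := Nat.exists_eq_add_of_le' (show 1 ≤ m by omega)
      exact exists_switchableLoop_of_odd m (by omega)

theorem theorem2 (n : ℕ) (hn : 3 ≤ n) (k : Cardinal.{u}) (hk : 4 ≤ k) :
    ∃ (S : Type u) (f : (Fin n → S) → S),
      Cardinal.mk S = k ∧ IsNQuasigroup f ∧ ¬ IsPermutablyReducible f := by
  obtain ⟨S, hS, ⟨L⟩⟩ := exists_switchableLoop k hk
  obtain ⟨n, rfl⟩ := Nat.exists_eq_add_of_le' (show 1 ≤ n by omega)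
  exact ⟨S, L.switched, hS, L.switched_isNQuasigroup _, L.switched_not_reducible⟩
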